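/- Let $U$ be a finite-dimensional complex vector space, and let $p\colon GL(U)\to PGL(U)$ be the canonical projection. Let $(\overline G,\overline H)$ be a (reductive) dual pair in $PGL(U)$, i.e. $\overline G$ and $\overline H$ are reductive algebraic subgroups of $PGL(U)$ with $Z_{PGL(U)}(\overline G)=\overline H$ and $Z_{PGL(U)}(\overline H)=\overline G$. Put $G=p^{-1}(\overline G)$ and $H=p^{-1}(\overline H)$, let $G^\circ$ and $H^\circ$ be their identity components, and let $\Gamma=G/G^\circ$ and $\Delta=H/H^\circ$ be their component groups. Then $\Gamma$ and $\Delta$ are finite abelian groups. Moreover, for all $g\in G$ and $h\in H$ the commutator $ghg^{-1}h^{-1}$ is a scalar $\mu(g,h)\in\mathbb C^\times$ whose value is a $(\dim U)$-th root of unity and depends only on the classes of $g$ in $\Gamma$ and of $h$ in $\Delta$ (for $U=0$, where all the groups are trivial, take $\mu=1$). The resulting maps $$\Delta\to\widehat\Gamma,\quad \delta\mapsto\mu(\cdot,\delta),\qquad\text{and}\qquad \Gamma\to\widehat\Delta,\quad \gamma\mapsto\mu(\gamma,\cdot),$$ where $\widehat A=\operatorname{Hom}(A,\mathbb C^\times)$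 denotes the character group, are group isomorphisms. -/

import Mathlib

namespace DualPair

section Zariski

variable (V : Type*) [AddCommGroup V] [Module ℂ V]

/-- The algebra of polynomial functions on a complex vector space, generated by the linear
functionals. -/
def polyFun : Subalgebra ℂ (V → ℂ) :=
  Algebra.adjoin ℂ (Set.range fun φ : V →ₗ[ℂ] ℂ => (φ : V → ℂ))

/-- The Zariski topology on a complex vector space: the principal open sets `f ≠ 0`, for `f`
a polynomial function, form a base of it. -/
abbrev zariski : TopologicalSpace V :=
  TopologicalSpace.generateFrom {s | ∃ f ∈ polyFun V, s = {x | f x ≠ 0}}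

variable {V}

theorem polyFun_comp {W : Type*} [AddCommGroup W] [Module ℂ W] (T : V →ₗ[ℂ] W) {f : W → ℂ}
    (hf : f ∈ polyFun W) : (fun x => f (T x)) ∈ polyFun V := by
  unfold polyFun at hf
  induction hf using Algebra.adjoin_induction with
  | mem f hf =>
    obtain ⟨φ, rfl⟩ := hf
    exact Algebra.subset_adjoin ⟨φ.comp T, rfl⟩
  | algebraMap r => exact (polyFun V).algebraMap_mem r
  | add f g _ _ h₁ h₂ => exact (polyFun V).add_mem h₁ h₂
  | mul f g _ _ h₁ h₂ => exact (polyFun V).mul_mem h₁ h₂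

/-- Linear maps are continuous in the Zariski topology. -/
theorem continuous_zariski {W : Type*} [AddCommGroup W] [Module ℂ W] (T : V →ₗ[ℂ] W) :
    @Continuous V W (zariski V) (zariski W) T := by
  let _ := zariski V
  refine continuous_generateFrom_iff.2 ?_
  rintro _ ⟨f, hf, rfl⟩
  exact TopologicalSpace.isOpen_generateFrom_of_mem ⟨_, polyFun_comp T hf, rfl⟩

/-- The Zariski closed sets are exactly the common zero sets of families of polynomial
functions. -/
theorem isClosed_zariski_iff (s : Set V) :
    @IsClosed V (zariski V) s ↔ ∃ S ⊆ (polyFun V : Set (V → ℂ)), s = {x | ∀ f ∈ S, f x = 0} := by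
  let _ := zariski V
  constructor
  · intro hs
    have hB : TopologicalSpace.IsTopologicalBasis
        {s : Set V | ∃ f ∈ polyFun V, s = {x | f x ≠ 0}} := by
      refine ⟨?_, ?_, rfl⟩
      · rintro _ ⟨f, hf, rfl⟩ _ ⟨g, hg, rfl⟩ x ⟨hx, hx'⟩
        refine ⟨_, ⟨f * g, (polyFun V).mul_mem hf hg, rfl⟩, mul_ne_zero hx hx', fun y hy => ?_⟩
        exact ⟨left_ne_zero_of_mul hy, right_ne_zero_of_mul hy⟩
      · exact Set.eq_univ_of_forall fun x =>
          ⟨_, ⟨1, (polyFun V).one_mem, rfl⟩, one_ne_zero (α := ℂ)⟩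
    refine ⟨{f | f ∈ polyFun V ∧ ∀ x ∈ s, f x = 0}, fun f hf => hf.1, ?_⟩
    ext x
    refine ⟨fun hx f hf => hf.2 x hx, fun hx => ?_⟩
    by_contra hxs
    obtain ⟨_, ⟨f, hf, rfl⟩, hfx, hfs⟩ := hB.exists_subset_of_mem_open (Set.mem_compl hxs) hs.isOpen_compl
    exact hfx (hx f ⟨hf, fun y hy => by_contra fun h => hfs h hy⟩)
  · rintro ⟨S, hS, rfl⟩
    rw [Set.ofPred_forall]
    refine isClosed_iInter fun f => ?_
    rw [Set.ofPred_forall]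
    refine isClosed_iInter fun hf => ?_
    exact ⟨TopologicalSpace.isOpen_generateFrom_of_mem ⟨f, hS hf, rfl⟩⟩

end Zariski

section Groups

variable (U : Type*) [AddCommGroup U] [Module ℂ U]

/-- The general linear group of `U`. -/
abbrev GLin : Type _ := LinearMap.GeneralLinearGroup ℂ U

/-- The projective general linear group: the quotient of `GLin U` by its center (the scalars). -/
abbrev PGLin : Type _ := GLin U ⧸ Subgroup.center (GLin U)

/-- The canonical projection. -/
abbrev proj : GLin U →* PGLin U := QuotientGroup.mk' (Subgroup.center (GLin U))

/-- The Zariski topology on `GLin U`, induced from the vector space of endomorphisms (inverting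
`det` gives no new closed sets). Subgroups of `GLin U` carry the subspace topology and `PGLin U`
the quotient topology, which are their Zariski topologies. -/
instance zariskiGL : TopologicalSpace (GLin U) :=
  TopologicalSpace.induced (fun g : GLin U => (g : Module.End ℂ U)) (zariski (Module.End ℂ U))

variable {U}

instance : SeparatelyContinuousMul (GLin U) where
  continuous_const_mul {a} := by
    let _ := zariski (Module.End ℂ U)
    refine continuous_induced_rng.2 ?_
    exact (continuous_zariski (LinearMap.mulLeft ℂ (a : Module.End ℂ U))).comp
      continuous_induced_dom
  continuous_mul_const {a} := by
    let _ := zariski (Module.End ℂ U)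
    refine continuous_induced_rng.2 ?_
    exact (continuous_zariski (LinearMap.mulRight ℂ (a : Module.End ℂ U))).comp
      continuous_induced_dom

/-- Translates of the component of the identity in a subgroup. -/
theorem mul_mul_mem_connectedComponent (G : Subgroup (GLin U)) (a b : G) {c d : G}
    (hc : c ∈ connectedComponent (1 : G)) (hd : d ∈ connectedComponent (1 : G))
    (h : a * c * b = 1) : a * d * b ∈ connectedComponent (1 : G) := by
  have hcont : Continuous fun x : G => a * x * b :=
    Continuous.subtype_mk (((continuous_mul_const (b : GLin U)).comp
      (continuous_const_mul (a : GLin U))).comp continuous_subtype_val) _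
  have := hcont.image_connectedComponent_subset c
    ⟨d, by rwa [connectedComponent_eq hc] at hd, rfl⟩
  simpa only [h] using this

/-- The identity component `G°` of a subgroup `G` of `GLin U`: the connected component of `1`
in the Zariski topology. -/
def identityComponent (G : Subgroup (GLin U)) : Subgroup G where
  carrier := connectedComponent (1 : G)
  one_mem' := mem_connectedComponent
  inv_mem' {c} hc := by
    simpa using mul_mul_mem_connectedComponent G c⁻¹ 1 hc mem_connectedComponent (by simp)
  mul_mem' {c d} hc hd := by
    have hc' : c⁻¹ ∈ connectedComponent (1 : G) := by
      simpa using mul_mul_mem_connectedComponent G c⁻¹ 1 hc mem_connectedComponent (by simp)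
    simpa using mul_mul_mem_connectedComponent G c 1 hc' hd (by simp)

instance (G : Subgroup (GLin U)) : (identityComponent G).Normal where
  conj_mem c hc g :=
    mul_mul_mem_connectedComponent G g g⁻¹ (c := 1) mem_connectedComponent hc (by simp)

/-- The component group `G / G°`. -/
abbrev ComponentGroup (G : Subgroup (GLin U)) : Type _ := G ⧸ identityComponent G

/-- An element of `PGLin U` is unipotent if it is the image of a unipotent element of `GLin U`. -/
def IsUnipotent (x : PGLin U) : Prop :=
  ∃ g : GLin U, proj U g = x ∧ IsNilpotent ((g : Module.End ℂ U) - 1)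

/-- An algebraic subgroup of `PGLin U` is reductive if its unipotent radical is trivial: it has no
nontrivial Zariski closed, connected, normal subgroup that consists of unipotent elements. -/
def IsReductive (G : Subgroup (PGLin U)) : Prop :=
  ∀ N : Subgroup (PGLin U), N ≤ G → (N.subgroupOf G).Normal → IsClosed (N : Set (PGLin U)) →
    IsConnected (N : Set (PGLin U)) → (∀ x ∈ N, IsUnipotent x) → N = ⊥

/-- A (reductive) dual pair in `PGLin U`: two reductive algebraic subgroups that are each other's
centralizers. -/
structure IsDualPair (G H : Subgroup (PGLin U)) : Prop where
  isClosed_left : IsClosed (G : Set (PGLin U))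
  isClosed_right : IsClosed (H : Set (PGLin U))
  isReductive_left : IsReductive G
  isReductive_right : IsReductive H
  centralizer_left : Subgroup.centralizer (G : Set (PGLin U)) = H
  centralizer_right : Subgroup.centralizer (H : Set (PGLin U)) = G

end Groups

end DualPair

/-! Elements of `G` and `H` commute up to scalars, so the commutator is a bimultiplicative pairing
`μ`; comparing determinants of `gh = μ hg` shows its values are roots of unity. The heart is that
the left kernel of `μ` is exactly `G°` (`ker_eq_identityComponent`). This kernel is the centralizer
of `H` in `GLin U`, which lies in `G`. It consists of the units of an algebra, so it is connected
through lines; it is also closed and of finite index, hence clopen, so it contains `G°`. The same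
holds for `H`. Thus `μ` descends to a pairing of the finite groups `Γ` and `Δ`, nondegenerate on
both sides. Each embeds in the character group of the other, so both are abelian, and counting makes
the embeddings bijective. -/

namespace DualPair

/-! ### Duality of finite groups. -/

section Pairing

variable {Γ Δ : Type*} [Group Γ] [Group Δ]

theorem mul_comm_of_injective {A : Type*} [CommGroup A] (f : Γ →* A)
    (hf : Function.Injective f) (x y : Γ) : x * y = y * x :=
  hf (by rw [map_mul, map_mul, mul_comm])

theorem finite_and_card_characters [Finite Γ] (hΓ : ∀ x y : Γ, x * y = y * x) :
    Finite (Γ →* ℂˣ) ∧ Nat.card (Γ →* ℂˣ) = Nat.card Γ := by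
  let _ : CommGroup Γ := { (inferInstance : Group Γ) with mul_comm := hΓ }
  obtain ⟨e⟩ := CommGroup.monoidHom_mulEquiv_of_hasEnoughRootsOfUnity Γ ℂ
  exact ⟨Finite.of_equiv _ e.symm.toEquiv, Nat.card_congr e.toEquiv⟩

/-- A pairing of finite groups with values in `ℂˣ` that is nondegenerate on both sides
is perfect. -/
theorem bijective_of_nondegenerate [Finite Γ] [Finite Δ] (B : Γ →* Δ →* ℂˣ)
    (hB : Function.Injective B) (hB' : Function.Injective B.flip) : Function.Bijective B := by
  obtain ⟨_, h₁⟩ := finite_and_card_characters (mul_comm_of_injective B hB)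
  obtain ⟨_, h₂⟩ := finite_and_card_characters (mul_comm_of_injective B.flip hB')
  -- The orders satisfy `|Γ| ≤ |Hom(Δ, ℂˣ)| = |Δ| ≤ |Hom(Γ, ℂˣ)| = |Γ|`.
  refine (Nat.bijective_iff_injective_and_card B).2 ⟨hB, le_antisymm ?_ ?_⟩
  · exact Nat.card_le_card_of_injective B hB
  · rw [h₂, ← h₁]
    exact Nat.card_le_card_of_injective B.flip hB'

end Pairing

/-! ### Lines of endomorphisms and connectedness of centralizers. -/

section Linear

variable {U : Type*} [AddCommGroup U] [Module ℂ U]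

/-- The endomorphisms `1 + t b` are invertible for all but finitely many `t`. -/
theorem finite_setOf_not_isUnit_one_add_smul [FiniteDimensional ℂ U] (b : Module.End ℂ U) :
    {t : ℂ | ¬ IsUnit (1 + t • b)}.Finite := by
  -- A bad `t` is nonzero and equals `-1/c` for an eigenvalue `c` of `b`.
  refine ((Module.End.finite_spectrum b).image fun c => -c⁻¹).subset fun t ht => ?_
  have ht0 : t ≠ 0 := by
    rintro rfl
    simp at ht
  refine ⟨-t⁻¹, fun hu => ht ?_, by simp⟩
  have h : 1 + t • b = (-t) • (algebraMap ℂ (Module.End ℂ U) (-t⁻¹) - b) := by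
    rw [Algebra.algebraMap_eq_smul_one, smul_sub, smul_smul]
    simp [ht0]
  rw [h]
  exact (isUnit_smul_iff (Units.mk0 (-t) (neg_ne_zero.2 ht0)) _).2 hu

/-- The center of `GLin U` consists of the scalars. -/
theorem exists_smul_of_mem_center [FiniteDimensional ℂ U] {g : GLin U}
    (hg : g ∈ Subgroup.center (GLin U)) :
    ∃ c : ℂ, (g : Module.End ℂ U) = c • 1 := by
  have hcomm (b : Module.End ℂ U) : b * g = g * b := by
    -- Commuting with the unit `1 + t b`, for some `t ≠ 0`, forces commuting with `b`.
    obtain ⟨t, ht⟩ : ∃ t : ℂ, t ∉ {t : ℂ | ¬ IsUnit (1 + t • b)} ∪ {0} :=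
      ((finite_setOf_not_isUnit_one_add_smul b).union (Set.finite_singleton 0)).exists_notMem
    simp only [Set.mem_union, Set.mem_ofPred_eq, not_or, not_not, Set.mem_singleton_iff] at ht
    obtain ⟨⟨u, hu⟩, ht0⟩ := ht
    have h := congrArg Units.val (Subgroup.mem_center_iff.1 hg u)
    simp only [Units.val_mul, hu, add_mul, mul_add, one_mul, mul_one, smul_mul_assoc,
      mul_smul_comm, add_right_inj] at h
    exact smul_right_injective _ ht0 h
  have hc : (g : Module.End ℂ U) ∈ Subalgebra.center ℂ (Module.End ℂ U) :=
    Subalgebra.mem_center_iff.2 hcomm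
  obtain ⟨c, hc⟩ := Algebra.IsCentral.mem_center_iff ℂ |>.1 hc
  exact ⟨c, by rw [hc, Algebra.algebraMap_eq_smul_one]⟩

theorem continuous_polyFun_comp_line {V : Type*} [AddCommGroup V] [Module ℂ V] (v w : V)
    {f : V → ℂ} (hf : f ∈ polyFun V) : Continuous fun t : ℂ => f (v + t • w) := by
  unfold polyFun at hf
  induction hf using Algebra.adjoin_induction with
  | mem f hf =>
    obtain ⟨φ, rfl⟩ := hf
    simp only [map_add, map_smul, smul_eq_mul]
    fun_prop
  | algebraMap r => exact continuous_const
  | add f g _ _ h₁ h₂ => exact h₁.add h₂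
  | mul f g _ _ h₁ h₂ => exact h₁.mul h₂

/-- The source carries the usual topology of `ℂ`, so connectedness there passes to Zariski
connectedness. -/
theorem continuous_zariski_line {V : Type*} [AddCommGroup V] [Module ℂ V] (v w : V) :
    @Continuous ℂ V _ (zariski V) fun t => v + t • w := by
  refine continuous_generateFrom_iff.2 ?_
  rintro _ ⟨f, hf, rfl⟩
  exact isOpen_ne_fun (continuous_polyFun_comp_line v w hf) continuous_const

theorem isClosed_zariski_singleton_zero (V : Type*) [AddCommGroup V] [Module ℂ V] :
    @IsClosed V (zariski V) {0} := by
  refine (isClosed_zariski_iff _).2 ⟨Set.range fun φ : V →ₗ[ℂ] ℂ => (φ : V → ℂ),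
    Algebra.subset_adjoin, ?_⟩
  ext x
  simp only [Set.mem_singleton_iff, Set.forall_mem_range, Set.mem_ofPred_eq]
  exact (Module.forall_dual_apply_eq_zero_iff ℂ x).symm

/-- The set of elements that commute with `h` is Zariski closed. -/
theorem isClosed_setOf_commute (h : GLin U) : IsClosed {g : GLin U | g * h = h * g} := by
  let _ := zariski (Module.End ℂ U)
  have hcont : Continuous fun g : GLin U =>
      (LinearMap.mulRight ℂ (h : Module.End ℂ U) - LinearMap.mulLeft ℂ (h : Module.End ℂ U)) g :=
    (continuous_zariski _).comp continuous_induced_dom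
  convert (isClosed_zariski_singleton_zero (Module.End ℂ U)).preimage hcont using 1
  ext g
  simp [Units.ext_iff, sub_eq_zero]

/-- If a subgroup `G` contains the centralizer of a set `S`, then this centralizer lies in the
identity component of `G`. -/
theorem mem_identityComponent_of_centralizer_le [FiniteDimensional ℂ U]
    {G : Subgroup (GLin U)} {S : Set (GLin U)}
    (hS : Subgroup.centralizer S ≤ G) (g : G) (hg : (g : GLin U) ∈ Subgroup.centralizer S) :
    g ∈ identityComponent G := by
  -- The line `1 + t (g - 1)` joins `1` at `t = 0` to `g` at `t = 1`; its invertible points still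
  -- centralize `S`.
  set b : Module.End ℂ U := (g : GLin U) - 1 with hb
  set T : Set ℂ := {t : ℂ | ¬ IsUnit (1 + t • b)}ᶜ with hT
  have hu (t : T) : IsUnit (1 + (t : ℂ) • b) := not_not.1 t.2
  have hmem (t : T) : (hu t).unit ∈ G := by
    refine hS (Subgroup.mem_centralizer_iff.2 fun s hs => Units.ext ?_)
    have h := congrArg Units.val (Subgroup.mem_centralizer_iff.1 hg s hs)
    simp only [Units.val_mul] at h
    simp [hb, mul_add, add_mul, mul_sub, sub_mul, h]
  have hcont : Continuous fun t : T => (⟨(hu t).unit, hmem t⟩ : G) := by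
    refine Continuous.subtype_mk (continuous_induced_rng.2 ?_) _
    let _ := zariski (Module.End ℂ U)
    exact (continuous_zariski_line 1 b).comp continuous_subtype_val
  -- Removing finitely many points from the real plane leaves it connected.
  have hconn : IsPreconnected T := by
    refine ((finite_setOf_not_isUnit_one_add_smul b).countable.isConnected_compl_of_one_lt_rank
      ?_).isPreconnected
    rw [Complex.rank_real_complex]
    exact Nat.one_lt_ofNat
  have := Subtype.preconnectedSpace hconn
  have h0 : (0 : ℂ) ∈ T := by simp [hT]
  have h1 : (1 : ℂ) ∈ T := by
    simp only [hT, hb, Set.mem_compl_iff, Set.mem_ofPred_eq, not_not, one_smul,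
      add_sub_cancel]
    exact (g : GLin U).isUnit
  refine (isPreconnected_range hcont).subset_connectedComponent ⟨⟨0, h0⟩, ?_⟩ ⟨⟨1, h1⟩, ?_⟩
  · exact Subtype.ext (Units.ext (by simp))
  · exact Subtype.ext (Units.ext (by simp [hb]))

end Linear

/-! ### The commutator pairing and its kernels. -/

section Commutator

variable {U : Type*} [AddCommGroup U] [Module ℂ U] {G H : Subgroup (GLin U)}

instance (G : Subgroup (GLin U)) : SeparatelyContinuousMul G where
  continuous_const_mul := Continuous.subtype_mk
    ((continuous_const_mul _).comp continuous_subtype_val) _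
  continuous_mul_const := Continuous.subtype_mk
    ((continuous_mul_const _).comp continuous_subtype_val) _

/-- `μ` is the commutator pairing of `G` and `H`. -/
def IsCommutatorPairing (μ : G →* H →* ℂˣ) : Prop :=
  ∀ (g : G) (h : H), ((g : GLin U) : Module.End ℂ U) * (h : GLin U) =
    (μ g h : ℂ) • (((h : GLin U) : Module.End ℂ U) * (g : GLin U))

theorem exists_isCommutatorPairing [FiniteDimensional ℂ U] [Nontrivial U]
    (hGH : ∀ g ∈ G, ∀ h ∈ H, g * h * g⁻¹ * h⁻¹ ∈ Subgroup.center (GLin U)) :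
    ∃ μ : G →* H →* ℂˣ, IsCommutatorPairing μ := by
  have hex (g : G) (h : H) : ∃ c : ℂˣ, ((g : GLin U) : Module.End ℂ U) * (h : GLin U) =
      (c : ℂ) • (((h : GLin U) : Module.End ℂ U) * (g : GLin U)) := by
    obtain ⟨c, hc⟩ := exists_smul_of_mem_center (hGH g g.2 h h.2)
    have hc0 : c ≠ 0 := by
      rintro rfl
      exact Units.ne_zero _ (by rw [hc, zero_smul])
    refine ⟨Units.mk0 c hc0, ?_⟩
    have := congrArg (· * ((h : GLin U) * (g : GLin U) : GLin U).val) hc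
    simp only [← Units.val_mul, smul_mul_assoc, one_mul] at this
    simpa [mul_assoc] using this
  choose m hm using hex
  -- As `U ≠ 0`, the unit `hg` is nonzero and the scalar is unique; this yields both
  -- multiplicativities.
  have huniq (g : G) (h : H) (c : ℂˣ) (hc : ((g : GLin U) : Module.End ℂ U) * (h : GLin U) =
      (c : ℂ) • (((h : GLin U) : Module.End ℂ U) * (g : GLin U))) : m g h = c := by
    rw [hm g h, ← Units.val_mul] at hc
    exact Units.ext (smul_left_injective ℂ (Units.ne_zero _) hc)
  refine ⟨MonoidHom.mk' (fun g => MonoidHom.mk' (m g) fun h h' => huniq _ _ _ ?_)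
    fun g g' => MonoidHom.ext fun h => huniq _ _ _ ?_, hm⟩
  · rw [Subgroup.coe_mul, Units.val_mul, ← mul_assoc, hm g h, smul_mul_assoc, mul_assoc,
      hm g h', mul_smul_comm, smul_smul, Units.val_mul, mul_assoc]
  · simp only [MonoidHom.mul_apply, MonoidHom.mk'_apply]
    rw [Subgroup.coe_mul, Units.val_mul, mul_assoc, hm g' h, mul_smul_comm, ← mul_assoc,
      hm g h, smul_mul_assoc, smul_smul, Units.val_mul, mul_assoc, mul_comm (m g h : ℂ)]

namespace IsCommutatorPairing

variable {μ : G →* H →* ℂˣ}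

/-- Exchanging `g` and `h` inverts the commutator, whence the inverse. -/
theorem flip (hμ : IsCommutatorPairing μ) : IsCommutatorPairing μ.flip⁻¹ := fun h g => by
  rw [hμ g h, smul_smul]
  simp

theorem coe_commutator (hμ : IsCommutatorPairing μ) (g : G) (h : H) :
    (((g : GLin U) * h * (g : GLin U)⁻¹ * (h : GLin U)⁻¹ : GLin U) : Module.End ℂ U) =
      (μ g h : ℂ) • (1 : Module.End ℂ U) := by
  have h1 : ((h : GLin U) : Module.End ℂ U) * (g : GLin U) *
      (((g : GLin U)⁻¹ : GLin U) * ((h : GLin U)⁻¹ : GLin U)) = 1 := by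
    simp only [← Units.val_mul]
    simp [mul_assoc]
  rw [mul_assoc, Units.val_mul, Units.val_mul, hμ g h, smul_mul_assoc, Units.val_mul, h1]

theorem apply_mem_rootsOfUnity (hμ : IsCommutatorPairing μ) (g : G) (h : H) :
    μ g h ∈ rootsOfUnity (Module.finrank ℂ U) ℂ := by
  have hd := congrArg LinearMap.det (hμ g h)
  rw [LinearMap.det_smul, map_mul, map_mul, mul_comm (LinearMap.det _)] at hd
  have h0 : LinearMap.det ((h : GLin U) : Module.End ℂ U) *
      LinearMap.det ((g : GLin U) : Module.End ℂ U) ≠ 0 := by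
    rw [← map_mul, ← Units.val_mul]
    exact ((Units.isUnit _).map LinearMap.det).ne_zero
  rw [mem_rootsOfUnity']
  exact mul_right_cancel₀ h0 (by rw [one_mul, ← hd])

theorem apply_eq_one_iff [Nontrivial U] (hμ : IsCommutatorPairing μ) (g : G) (h : H) :
    μ g h = 1 ↔ (g : GLin U) * h = h * g := by
  rw [Units.ext_iff, Units.ext_iff, Units.val_mul, Units.val_mul, hμ g h, Units.val_one]
  refine ⟨fun h1 => by rw [h1, one_smul], fun h1 => ?_⟩
  rw [← Units.val_mul] at h1
  exact smul_left_injective ℂ (Units.ne_zero ((h : GLin U) * (g : GLin U)))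
    (by simpa only [one_smul] using h1)

theorem mem_ker_iff [Nontrivial U] (hμ : IsCommutatorPairing μ) (g : G) :
    g ∈ μ.ker ↔ ∀ h : H, (g : GLin U) * h = h * g := by
  simp only [MonoidHom.mem_ker, MonoidHom.ext_iff, MonoidHom.one_apply, hμ.apply_eq_one_iff]

/-- The elements of `G` that commute with `H` form a subgroup of finite index. -/
theorem finiteIndex_ker [FiniteDimensional ℂ U] [Nontrivial U] (hμ : IsCommutatorPairing μ) :
    μ.ker.FiniteIndex := by
  -- Finitely many elements of `H` span the same subspace as `H`, and commuting with them suffices.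
  -- Each gives a character of `G` with finite image, so the kernel contains a finite intersection
  -- of finite-index subgroups.
  obtain ⟨s, hs, hspan⟩ := (Submodule.fg_span_iff_fg_span_finset_subset
    (Set.range fun h : H => ((h : GLin U) : Module.End ℂ U))).1
    (IsNoetherian.noetherian (R := ℂ) _)
  have hlift : ∀ x : s, ∃ h : H, ((h : GLin U) : Module.End ℂ U) = x := fun x => hs x.2
  choose k hk using hlift
  have hfin (x : s) : (μ.flip (k x)).ker.FiniteIndex := by
    have : NeZero (Module.finrank ℂ U) := ⟨Module.finrank_pos.ne'⟩
    have : Finite (μ.flip (k x)).range := by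
      have : Finite (rootsOfUnity (Module.finrank ℂ U) ℂ) := inferInstance
      refine Set.Finite.subset (s := {x | x ∈ rootsOfUnity (Module.finrank ℂ U) ℂ}) this ?_
      rintro _ ⟨g, rfl⟩
      exact hμ.apply_mem_rootsOfUnity g (k x)
    infer_instance
  have hle : ⨅ x : s, (μ.flip (k x)).ker ≤ μ.ker := by
    intro g hg
    rw [hμ.mem_ker_iff]
    intro h
    have hmem : ((h : GLin U) : Module.End ℂ U) ∈ Submodule.span ℂ (s : Set (Module.End ℂ U)) := by
      rw [← hspan]
      exact Submodule.subset_span ⟨h, rfl⟩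
    refine Units.ext ?_
    rw [Units.val_mul, Units.val_mul]
    generalize ((h : GLin U) : Module.End ℂ U) = x at hmem ⊢
    induction hmem using Submodule.span_induction with
    | mem x hx =>
      have := (hμ.apply_eq_one_iff g (k ⟨x, hx⟩)).1 (Subgroup.mem_iInf.1 hg ⟨x, hx⟩)
      simpa only [Units.ext_iff, Units.val_mul, hk] using this
    | zero => simp
    | add x y _ _ hx hy => rw [mul_add, add_mul, hx, hy]
    | smul c x _ hx => rw [mul_smul_comm, smul_mul_assoc, hx]
  have := Subgroup.finiteIndex_iInf hfin
  exact Subgroup.finiteIndex_of_le hle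

theorem isClosed_ker [Nontrivial U] (hμ : IsCommutatorPairing μ) : IsClosed (μ.ker : Set G) := by
  have h : (μ.ker : Set G) =
      ⋂ h : H, ((↑) : G → GLin U) ⁻¹' {g | g * (h : GLin U) = (h : GLin U) * g} := by
    ext g
    simp [hμ.mem_ker_iff]
  rw [h]
  exact isClosed_iInter fun h => (isClosed_setOf_commute _).preimage continuous_subtype_val

/-- If `G` contains the centralizer of `H`, then this centralizer is the identity component
of `G`. -/
theorem ker_eq_identityComponent [FiniteDimensional ℂ U] [Nontrivial U] (hμ : IsCommutatorPairing μ)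
    (hG : Subgroup.centralizer (H : Set (GLin U)) ≤ G) : μ.ker = identityComponent G := by
  refine le_antisymm (fun g hg => ?_) ?_
  · refine mem_identityComponent_of_centralizer_le hG g
      (Subgroup.mem_centralizer_iff.2 fun h hh => ?_)
    exact ((hμ.mem_ker_iff g).1 hg ⟨h, hh⟩).symm
  -- A closed subgroup of finite index is also open, so it contains the component of `1`.
  · have := hμ.finiteIndex_ker
    exact IsClopen.connectedComponent_subset
      ⟨hμ.isClosed_ker, μ.ker.isOpen_of_isClosed_of_finiteIndex hμ.isClosed_ker⟩ μ.ker.one_mem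

end IsCommutatorPairing

theorem finite_componentGroup_of_eq {G : Subgroup (GLin U)} {K : Subgroup G} [K.FiniteIndex]
    (hK : K = identityComponent G) : Finite (ComponentGroup G) := by
  subst hK
  infer_instance

end Commutator

/-- The preimages of the members of a dual pair centralize each other modulo scalars. -/
theorem mem_comap_centralizer_iff {U : Type*} [AddCommGroup U] [Module ℂ U]
    (K : Subgroup (PGLin U)) (g : GLin U) :
    g ∈ (Subgroup.centralizer (K : Set (PGLin U))).comap (proj U) ↔
      ∀ h ∈ K.comap (proj U), g * h * g⁻¹ * h⁻¹ ∈ Subgroup.center (GLin U) := by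
  have key (h : GLin U) : g * h * g⁻¹ * h⁻¹ ∈ Subgroup.center (GLin U) ↔
      proj U h * proj U g = proj U g * proj U h := by
    rw [← QuotientGroup.eq_one_iff, ← QuotientGroup.mk'_apply]
    simp only [map_mul, map_inv]
    rw [mul_inv_eq_one, mul_inv_eq_iff_eq_mul, eq_comm]
  simp only [key, Subgroup.mem_comap, Subgroup.mem_centralizer_iff, SetLike.mem_coe]
  refine ⟨fun h x hx => h _ hx, fun h y hy => ?_⟩
  obtain ⟨x, rfl⟩ := QuotientGroup.mk'_surjective _ y
  exact h x hy

end DualPair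

theorem mainTheorem4 {U : Type*} [AddCommGroup U] [Module ℂ U] [FiniteDimensional ℂ U]
    (Gbar Hbar : Subgroup (DualPair.PGLin U)) (hGH : DualPair.IsDualPair Gbar Hbar)
    (G H : Subgroup (DualPair.GLin U))
    (hG : G = Gbar.comap (DualPair.proj U)) (hH : H = Hbar.comap (DualPair.proj U)) :
    Finite (DualPair.ComponentGroup G) ∧ Finite (DualPair.ComponentGroup H) ∧
    (∀ x y : DualPair.ComponentGroup G, x * y = y * x) ∧
    (∀ x y : DualPair.ComponentGroup H, x * y = y * x) ∧
    ∃ (φ : DualPair.ComponentGroup H ≃* (DualPair.ComponentGroup G →* ℂˣ))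
      (ψ : DualPair.ComponentGroup G ≃* (DualPair.ComponentGroup H →* ℂˣ)),
      ∀ (g : G) (h : H),
        φ (QuotientGroup.mk h) (QuotientGroup.mk g) ∈ rootsOfUnity (Module.finrank ℂ U) ℂ ∧
        (((g : DualPair.GLin U) * h * (g : DualPair.GLin U)⁻¹ * (h : DualPair.GLin U)⁻¹ :
            DualPair.GLin U) : Module.End ℂ U) =
          (φ (QuotientGroup.mk h) (QuotientGroup.mk g) : ℂ) • (1 : Module.End ℂ U) ∧
        ψ (QuotientGroup.mk g) (QuotientGroup.mk h) =
          φ (QuotientGroup.mk h) (QuotientGroup.mk g) := by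
  have hG' (g : DualPair.GLin U) : g ∈ G ↔ ∀ h ∈ H, g * h * g⁻¹ * h⁻¹ ∈
      Subgroup.center (DualPair.GLin U) := by
    rw [hG, hH, ← hGH.centralizer_right]
    exact DualPair.mem_comap_centralizer_iff Hbar g
  have hH' (h : DualPair.GLin U) : h ∈ H ↔ ∀ g ∈ G, h * g * h⁻¹ * g⁻¹ ∈
      Subgroup.center (DualPair.GLin U) := by
    rw [hG, hH, ← hGH.centralizer_left]
    exact DualPair.mem_comap_centralizer_iff Gbar h
  rcases subsingleton_or_nontrivial U with hU | hU
  -- For `U = 0` the commutator does not determine a scalar; all groups are trivial and the value is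
  -- `1`.
  · have (x : DualPair.ComponentGroup G) : x = 1 := by
      obtain ⟨g, rfl⟩ := QuotientGroup.mk_surjective x
      exact congrArg _ (Subsingleton.elim g 1)
    have (x : DualPair.ComponentGroup H) : x = 1 := by
      obtain ⟨g, rfl⟩ := QuotientGroup.mk_surjective x
      exact congrArg _ (Subsingleton.elim g 1)
    have : Subsingleton (DualPair.ComponentGroup G) := ⟨fun x y => by simp only [*]⟩
    have : Subsingleton (DualPair.ComponentGroup H) := ⟨fun x y => by simp only [*]⟩
    have : Subsingleton (DualPair.ComponentGroup G →* ℂˣ) :=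
      ⟨fun a b => MonoidHom.ext fun x => by rw [Subsingleton.elim x 1, map_one, map_one]⟩
    have : Subsingleton (DualPair.ComponentGroup H →* ℂˣ) :=
      ⟨fun a b => MonoidHom.ext fun x => by rw [Subsingleton.elim x 1, map_one, map_one]⟩
    refine ⟨inferInstance, inferInstance, fun _ _ => Subsingleton.elim _ _,
      fun _ _ => Subsingleton.elim _ _,
      @MulEquiv.ofUnique _ _ (uniqueOfSubsingleton 1) (uniqueOfSubsingleton 1) _ _,
      @MulEquiv.ofUnique _ _ (uniqueOfSubsingleton 1) (uniqueOfSubsingleton 1) _ _, fun g h => ?_⟩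
    simp [Subsingleton.elim g 1, Subsingleton.elim h 1]
  have hcG : Subgroup.centralizer (H : Set (DualPair.GLin U)) ≤ G := fun g hg => (hG' g).2 fun h hh => by
    rw [← Subgroup.mem_centralizer_iff.1 hg h hh]
    simp
  have hcH : Subgroup.centralizer (G : Set (DualPair.GLin U)) ≤ H := fun h hh => (hH' h).2 fun g hg => by
    rw [← Subgroup.mem_centralizer_iff.1 hh g hg]
    simp
  obtain ⟨μ, hμ⟩ := DualPair.exists_isCommutatorPairing fun g hg => (hG' g).1 hg
  have hkG := hμ.ker_eq_identityComponent hcG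
  have hkH := hμ.flip.ker_eq_identityComponent hcH
  have := hμ.finiteIndex_ker
  have := hμ.flip.finiteIndex_ker
  have := DualPair.finite_componentGroup_of_eq hkG
  have := DualPair.finite_componentGroup_of_eq hkH
  have memG (g : G) : g ∈ DualPair.identityComponent G ↔ ∀ h, μ g h = 1 := by
    rw [← hkG, MonoidHom.mem_ker, MonoidHom.ext_iff]
    rfl
  have memH (h : H) : h ∈ DualPair.identityComponent H ↔ ∀ g, μ g h = 1 := by
    rw [← hkH, MonoidHom.mem_ker, MonoidHom.inv_apply, inv_eq_one, MonoidHom.ext_iff]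
    rfl
  -- Descend in the variable of `H` first, then in that of `G`.
  let B : DualPair.ComponentGroup G →* DualPair.ComponentGroup H →* ℂˣ :=
    QuotientGroup.lift _ (MonoidHom.flip (QuotientGroup.lift _ μ.flip fun h hh =>
      MonoidHom.ext ((memH h).1 hh))) fun g hg => MonoidHom.ext fun y => by
        obtain ⟨h, rfl⟩ := QuotientGroup.mk_surjective y
        exact (memG g).1 hg h
  have hB (g : G) (h : H) : B (QuotientGroup.mk g) (QuotientGroup.mk h) = μ g h := rfl
  have hinj : Function.Injective B := (injective_iff_map_eq_one B).2 fun x hx => by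
    obtain ⟨g, rfl⟩ := QuotientGroup.mk_surjective x
    refine (QuotientGroup.eq_one_iff g).2 ((memG g).2 fun h => ?_)
    rw [← hB, hx, MonoidHom.one_apply]
  have hinj' : Function.Injective B.flip := (injective_iff_map_eq_one B.flip).2 fun y hy => by
    obtain ⟨h, rfl⟩ := QuotientGroup.mk_surjective y
    refine (QuotientGroup.eq_one_iff h).2 ((memH h).2 fun g => ?_)
    rw [← hB, ← MonoidHom.flip_apply, hy, MonoidHom.one_apply]
  exact ⟨inferInstance, inferInstance, DualPair.mul_comm_of_injective B hinj,
    DualPair.mul_comm_of_injective B.flip hinj',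
    MulEquiv.ofBijective B.flip (DualPair.bijective_of_nondegenerate B.flip hinj' hinj),
    MulEquiv.ofBijective B (DualPair.bijective_of_nondegenerate B hinj hinj'),
    fun g h => ⟨hμ.apply_mem_rootsOfUnity g h, hμ.coe_commutator g h, rfl⟩⟩
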